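/- **Setting.** For cutoffs $\Lambda_1,\Lambda_2\in\mathbb N$ consider one qubit and two bosonic modes, with state space $\mathbb C^2\otimes\mathbb C^{\Lambda_1+1}\otimes\mathbb C^{\Lambda_2+1}$. On a mode with cutoff $\Lambda$ and Fock basis $|0\rangle,\dots,|\Lambda\rangle$, let $a$ be the truncated annihilation operator ($a|n\rangle=\sqrt n\,|n-1\rangle$, $a|0\rangle=0$), $\hat x=\tfrac12(a+a^\dagger)$ and $\hat p=-\tfrac i2(a-a^\dagger)$. Let $\hat x_m,\hat p_m$ denote these operators on mode $m\in\{1,2\}$, acting as the identity on the other mode. Let $\|\cdot\|$ be the operator norm and, for an operator $A$ on the two modes and real $t$, let $$\mathcal B_A(t)=\exp\left(it\begin{bmatrix}0&A\\A^\dagger&0\end{bmatrix}\right).$$ Suppose the qubit-conditional displacements $e^{i\theta\hat x_m\sigma^j}$ and $e^{i\theta\hat p_m\sigma^j}$, with $m\in\{1,2\}$, $j\in\{x,y,z\}$, $\theta\in\mathbb R$, can be implemented exactly; call them native exponentials. Put $$C=\max\left(\|\hat x_1\hat x_2+\hat p_1\hat p_2\|,\ \|\hat x_1\|^2,\ \|\hat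 x_2\|^2,\ \|\hat p_1\|^2,\ \|\hat p_2\|^2\right).$$ **Theorem.** For every integer $p\ge1$ the block encoding $\mathcal B_{\hat x_1\hat x_2+\hat p_1\hat p_2}(t)$ (the conditional beam splitter) can be approximated by a product of native exponentials with error $O((Ct)^{p+1/2})$, using at most $4\cdot5^{p/2-1/4}$ synthesized exponentials of $\hat x_1\hat x_2$ and $\hat p_1\hat p_2$, each made of at most $8\cdot 6^{p-1}$ native exponentials. Precisely, there are, depending only on $p$, * a constant $K$; * for every $s\in\mathbb R$, products $\widetilde{\mathcal B}_{\hat x_1\hat x_2}(s)$ and $\widetilde{\mathcal B}_{\hat p_1\hat p_2}(s)$, each of at most $8\cdot 6^{p-1}$ native exponentials whose types and angles depend only on $p$ and $s$ (not on the cutoffs); * a finite sequence $(Q_1,c_1),\dots,(Q_N,c_N)$ with $Q_k\in\{\hat x_1\hat x_2,\ \hat p_1\hat p_2\}$, $c_k\in\mathbb R$ and $N\le 4\cdot5^{p/2-1/4}$, such that for all cutoffs $\Lambda_1,\Lambda_2$: 1. for all $s\in\mathbb R$, $$\left\|\widetilde{\mathcal B}_{\hat x_1\hat x_2}(s)-\mathcal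 B_{\hat x_1\hat x_2}(s)\right\|\le K\left(\max(\|\hat x_1\|^2,\|\hat x_2\|^2)\,|s|\right)^{p+1/2},$$ and the same holds with $\hat p$ in place of $\hat x$; 2. for all $t\ge0$, $$\left\|\widetilde{\mathcal B}_{Q_1}(c_1t)\,\widetilde{\mathcal B}_{Q_2}(c_2t)\cdots\widetilde{\mathcal B}_{Q_N}(c_Nt)-\mathcal B_{\hat x_1\hat x_2+\hat p_1\hat p_2}(t)\right\|\le K\,(Ct)^{p+1/2}.$$ -/

import Mathlib

open scoped Matrix Kronecker Matrix.Norms.L2Operator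

namespace BeamSplitter

noncomputable section

/-- The annihilation operator of a mode truncated to at most `Λ` bosons, in the Fock basis
`|0⟩, …, |Λ⟩`: `a |n⟩ = √n |n - 1⟩`, compressed by the projector onto these states. -/
def annihilation (Λ : ℕ) : Matrix (Fin (Λ + 1)) (Fin (Λ + 1)) ℂ :=
  Matrix.of fun m n => if (m : ℕ) + 1 = (n : ℕ) then ((Real.sqrt (n : ℕ) : ℝ) : ℂ) else 0

/-- The position operator `x̂ = (a + a†) / 2` of a truncated mode. -/
def position (Λ : ℕ) : Matrix (Fin (Λ + 1)) (Fin (Λ + 1)) ℂ :=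
  (1 / 2 : ℂ) • (annihilation Λ + (annihilation Λ)ᴴ)

/-- The momentum operator `p̂ = -(i / 2) (a - a†)` of a truncated mode. -/
def momentum (Λ : ℕ) : Matrix (Fin (Λ + 1)) (Fin (Λ + 1)) ℂ :=
  (-(Complex.I / 2)) • (annihilation Λ - (annihilation Λ)ᴴ)

/-- The two phase-space quadratures. -/
inductive Quadrature
  | x
  | p

/-- The two bosonic modes. -/
inductive Mode
  | one
  | two

/-- The three Pauli axes. -/
inductive Axis
  | x
  | y
  | z

/-- The quadrature operator (`x̂` or `p̂`) of a single truncated mode. -/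
def quadrature (Λ : ℕ) : Quadrature → Matrix (Fin (Λ + 1)) (Fin (Λ + 1)) ℂ
  | .x => position Λ
  | .p => momentum Λ

/-- The Pauli matrices `σ^x`, `σ^y`, `σ^z`. -/
def pauli : Axis → Matrix (Fin 2) (Fin 2) ℂ
  | .x => !![0, 1; 1, 0]
  | .y => !![0, -Complex.I; Complex.I, 0]
  | .z => !![1, 0; 0, -1]

/-- Basis of the two-mode space, with cutoff `Λ₁` in mode one and `Λ₂` in mode two. -/
abbrev TwoMode (Λ₁ Λ₂ : ℕ) : Type := Fin (Λ₁ + 1) × Fin (Λ₂ + 1)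

/-- Basis of the space of the qubit together with the two modes. -/
abbrev Hybrid (Λ₁ Λ₂ : ℕ) : Type := Fin 2 × TwoMode Λ₁ Λ₂

/-- The quadrature operator of one of the two modes (`x̂_m` or `p̂_m`), acting on the two-mode
space as the identity on the other mode. -/
def modeOp (Λ₁ Λ₂ : ℕ) (Q : Quadrature) : Mode → Matrix (TwoMode Λ₁ Λ₂) (TwoMode Λ₁ Λ₂) ℂ
  | .one => quadrature Λ₁ Q ⊗ₖ (1 : Matrix (Fin (Λ₂ + 1)) (Fin (Λ₂ + 1)) ℂ)
  | .two => (1 : Matrix (Fin (Λ₁ + 1)) (Fin (Λ₁ + 1)) ℂ) ⊗ₖ quadrature Λ₂ Q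

/-- The product `x̂₁ x̂₂` or `p̂₁ p̂₂`. -/
def quadProduct (Λ₁ Λ₂ : ℕ) (Q : Quadrature) : Matrix (TwoMode Λ₁ Λ₂) (TwoMode Λ₁ Λ₂) ℂ :=
  modeOp Λ₁ Λ₂ Q .one * modeOp Λ₁ Λ₂ Q .two

/-- The beam-splitter operator `x̂₁ x̂₂ + p̂₁ p̂₂`. -/
def beamSplitterOp (Λ₁ Λ₂ : ℕ) : Matrix (TwoMode Λ₁ Λ₂) (TwoMode Λ₁ Λ₂) ℂ :=
  quadProduct Λ₁ Λ₂ .x + quadProduct Λ₁ Λ₂ .p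

/-- The block encoding `𝓑_A(t) = exp (i t [[0, A], [A†, 0]])`; the blocks are indexed by the
computational basis of the qubit. -/
def blockEncoding {n : Type} [Fintype n] [DecidableEq n] (A : Matrix n n ℂ) (t : ℝ) :
    Matrix (Fin 2 × n) (Fin 2 × n) ℂ :=
  NormedSpace.exp ((Complex.I * (t : ℂ)) •
    ((!![0, 1; 0, 0] : Matrix (Fin 2) (Fin 2) ℂ) ⊗ₖ A +
      (!![0, 0; 1, 0] : Matrix (Fin 2) (Fin 2) ℂ) ⊗ₖ Aᴴ))

/-- A native gate: the name of one exponential `exp (i θ x̂_m σ^j)` or `exp (i θ p̂_m σ^j)`. -/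
structure Gate where
  quad : Quadrature
  mode : Mode
  axis : Axis
  angle : ℝ

/-- The unitary of a native gate. -/
def Gate.eval (Λ₁ Λ₂ : ℕ) (g : Gate) : Matrix (Hybrid Λ₁ Λ₂) (Hybrid Λ₁ Λ₂) ℂ :=
  NormedSpace.exp ((Complex.I * (g.angle : ℂ)) •
    (pauli g.axis ⊗ₖ modeOp Λ₁ Λ₂ g.quad g.mode))

/-- A circuit is a finite sequence of native gates. -/
abbrev Circuit : Type := List Gate

/-- The unitary of a circuit: the product of its gates, in the order listed. -/
def Circuit.eval (Λ₁ Λ₂ : ℕ) (c : Circuit) : Matrix (Hybrid Λ₁ Λ₂) (Hybrid Λ₁ Λ₂) ℂ :=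
  (c.map (Gate.eval Λ₁ Λ₂)).prod

/-- `max (‖x̂₁‖², ‖x̂₂‖²)` or `max (‖p̂₁‖², ‖p̂₂‖²)`, in the operator norm. -/
def quadConst (Λ₁ Λ₂ : ℕ) (Q : Quadrature) : ℝ :=
  max (‖modeOp Λ₁ Λ₂ Q .one‖ ^ 2) (‖modeOp Λ₁ Λ₂ Q .two‖ ^ 2)

/-- `C = max (‖x̂₁ x̂₂ + p̂₁ p̂₂‖, ‖x̂₁‖², ‖x̂₂‖², ‖p̂₁‖², ‖p̂₂‖²)`, in the operator norm. -/
def beamSplitterConst (Λ₁ Λ₂ : ℕ) : ℝ :=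
  max ‖beamSplitterOp Λ₁ Λ₂‖ (max (quadConst Λ₁ Λ₂ .x) (quadConst Λ₁ Λ₂ .p))

end

end BeamSplitter

/-! Two product formulas are nested. Inner one: the commutator of $i\sigma^z\hat x_1$ and
$i\sigma^y\hat x_2$ is $2i\sigma^x\hat x_1\hat x_2$, because the Pauli factors anticommute while the
modes commute. At $z=\sqrt{|s|/2}$ a commutator formula with error $O(z^{2p+1})$ thus gives
$\mathcal B_{\hat x_1\hat x_2}(s)$ with error $O(|s|^{p+1/2})$; the same works for $\hat p$. The
group commutator has error $O(z^3)$, and each sixfold step gains two orders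
(`exists_commutator_word`). Outer one: Strang splitting followed by Suzuki's fivefold recursion
separates $\hat x_1\hat x_2$ from $\hat p_1\hat p_2$ (`exists_symmetric_word`).

Both formulas are fixed words, and their order is a statement about germs at $0$ of analytic
functions in an arbitrary complex Banach algebra. Constants independent of the cutoffs come from one
application of it in the $\ell^\infty$ product of all normalised generator families over all
cutoffs; evaluation at an index is a contractive homomorphism, and scaling restores the norms. For
large times, unitarity bounds the error by $2$, which turns the local estimate into a global one.
Finally, errors of contractions add along a product (`norm_list_prod_sub_le`). -/

namespace BeamSplitter

open Asymptotics Filter Topology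

/-! ### Calculus of leading error terms at the origin -/

section Asymptotics

variable {𝔸 : Type*} [NormedRing 𝔸]

lemma isBigO_pow_of_le {f : ℂ → 𝔸} {m n : ℕ} (h : m ≤ n) (hf : f =O[𝓝 0] fun z : ℂ => z ^ n) :
    f =O[𝓝 0] fun z : ℂ => z ^ m :=
  hf.trans <| IsBigO.of_bound 1 <| by
    filter_upwards [Metric.ball_mem_nhds (0 : ℂ) one_pos] with z hz
    rw [norm_pow, norm_pow, one_mul]
    exact pow_le_pow_of_le_one (norm_nonneg z) (mem_ball_zero_iff.mp hz).le h

lemma isBigO_pow_mul {f g : ℂ → 𝔸} {m n k : ℕ} (h : k ≤ m + n)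
    (hf : f =O[𝓝 0] fun z : ℂ => z ^ m) (hg : g =O[𝓝 0] fun z : ℂ => z ^ n) :
    (fun z => f z * g z) =O[𝓝 0] fun z : ℂ => z ^ k := by
  refine isBigO_pow_of_le h ?_
  simpa only [pow_add] using hf.mul hg

lemma isBigO_pow_comp_mul {f : ℂ → 𝔸} {n : ℕ} (hf : f =O[𝓝 0] fun z : ℂ => z ^ n) (c : ℂ) :
    (fun z => f (c * z)) =O[𝓝 0] fun z : ℂ => z ^ n := by
  have ht : Tendsto (fun z : ℂ => c * z) (𝓝 0) (𝓝 0) := by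
    have : Continuous fun z : ℂ => c * z := by fun_prop
    simpa using this.tendsto 0
  refine (hf.comp_tendsto ht).trans ?_
  simp only [Function.comp_def, mul_pow]
  exact isBigO_const_mul_self _ _ _

lemma isBigO_pow_zero {f : ℂ → 𝔸} (hf : ContinuousAt f 0) :
    f =O[𝓝 0] fun z : ℂ => z ^ 0 := by
  simp only [pow_zero]
  exact hf.isBigO_one ℂ

/-- To order `n + j`, the function `f` is the sum of `V`, which is `1 + O(z ^ j)`, and of a
perturbation `R`, which is `O(z ^ n)`. -/
structure Perturbs (j n : ℕ) (f V R : ℂ → 𝔸) : Prop where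
  pert : R =O[𝓝 0] fun z : ℂ => z ^ n
  unit : (fun z => V z - 1) =O[𝓝 0] fun z : ℂ => z ^ j
  rest : (fun z => f z - V z - R z) =O[𝓝 0] fun z : ℂ => z ^ (n + j)

namespace Perturbs

variable {j n : ℕ} {f g V W R S : ℂ → 𝔸}

lemma bounded_unit (h : Perturbs j n f V R) : V =O[𝓝 0] fun z : ℂ => z ^ 0 := by
  simpa using (isBigO_pow_of_le (Nat.zero_le _) h.unit).add
    (isBigO_pow_zero (f := fun _ => (1 : 𝔸)) continuousAt_const)

lemma bounded (h : Perturbs j n f V R) : f =O[𝓝 0] fun z : ℂ => z ^ 0 := by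
  refine (((isBigO_pow_of_le (Nat.zero_le _) h.rest).add h.bounded_unit).add
    (isBigO_pow_of_le (Nat.zero_le _) h.pert)).congr_left fun z => ?_
  abel

lemma sub_one (h : Perturbs j n f V R) (hjn : j ≤ n) :
    (fun z => f z - 1) =O[𝓝 0] fun z : ℂ => z ^ j := by
  refine (((isBigO_pow_of_le (by omega) h.rest).add h.unit).add
    (isBigO_pow_of_le hjn h.pert)).congr_left fun z => ?_
  abel

/-- Leading errors add, without conjugation: every cross term pairs a factor $O(z^n)$ with one that
is $O(z^j)$, and the product of the two perturbations is $O(z^{2n})$ with $j\le n$. -/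
lemma mul (hf : Perturbs j n f V R) (hg : Perturbs j n g W S) (hjn : j ≤ n) :
    Perturbs j n (fun z => f z * g z) (fun z => V z * W z) (fun z => R z + S z) where
  pert := hf.pert.add hg.pert
  unit := by
    refine ((isBigO_pow_mul (k := j) (by omega) hf.unit hg.bounded_unit).add
      hg.unit).congr_left fun z => ?_
    noncomm_ring
  rest := by
    refine (((((isBigO_pow_mul (k := n + j) (by omega) hf.rest hg.bounded).add
      (isBigO_pow_mul (k := n + j) (by omega) hf.bounded_unit hg.rest)).add
      (isBigO_pow_mul (k := n + j) (by omega) hf.pert hg.rest)).add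
      (isBigO_pow_mul (k := n + j) (by omega) hf.unit hg.pert)).add
      ((isBigO_pow_mul (k := n + j) (by omega) hf.pert hg.unit).add
      (isBigO_pow_mul (k := n + j) (by omega) hf.pert hg.pert))).congr_left fun z => ?_
    noncomm_ring

/-- Inversion flips the sign of the leading error: $g-W=-g(f-V)W$, and replacing the outer factors
by $1$ costs only $O(z^{n+j})$. -/
lemma inv (hf : Perturbs j n f V R) (hjn : j ≤ n) (hfg : ∀ z, g z * f z = 1)
    (hVW : ∀ z, W z * V z = 1) (hWV : ∀ z, V z * W z = 1)
    (hg : g =O[𝓝 0] fun z : ℂ => z ^ 0) (hW : W =O[𝓝 0] fun z : ℂ => z ^ 0) :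
    Perturbs j n g W (fun z => -R z) := by
  have hunit : (fun z => W z - 1) =O[𝓝 0] fun z : ℂ => z ^ j :=
    (isBigO_pow_mul (k := j) (by omega) hW hf.unit).neg_left.congr_left fun z => by
      rw [mul_sub, hVW, mul_one, neg_sub]
  have hgu : (fun z => g z - 1) =O[𝓝 0] fun z : ℂ => z ^ j :=
    (isBigO_pow_mul (k := j) (by omega) hg (hf.sub_one hjn)).neg_left.congr_left fun z => by
      rw [mul_sub, hfg, mul_one, neg_sub]
  refine ⟨hf.pert.neg_left, hunit, ?_⟩
  have h1 := isBigO_pow_mul (k := n + j) (by omega)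
    (isBigO_pow_mul (k := n + j) (by omega) hg hf.rest) hW
  have h2 := isBigO_pow_mul (k := n + j) (by omega) hgu hf.pert
  have h3 := isBigO_pow_mul (k := n + j) (by omega)
    (isBigO_pow_mul (k := n) (by omega) hg hf.pert) hunit
  refine ((h1.add h2).add h3).neg_left.congr_left fun z => ?_
  have e1 : g z * (f z - V z - R z) * W z = W z - g z - g z * R z * W z := by
    rw [mul_sub, mul_sub, hfg, sub_mul, sub_mul, one_mul, mul_assoc (g z) (V z), hWV, mul_one]
  rw [e1]
  noncomm_ring

lemma comp_mul (hf : Perturbs j n f V R) (c : ℂ) :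
    Perturbs j n (fun z => f (c * z)) (fun z => V (c * z)) (fun z => R (c * z)) :=
  ⟨isBigO_pow_comp_mul hf.pert c, isBigO_pow_comp_mul hf.unit c, isBigO_pow_comp_mul hf.rest c⟩

end Perturbs

variable [NormedAlgebra ℂ 𝔸]

/-- Analyticity upgrades a bound to an expansion: $f=z^n g$ with $g$ analytic, and $D=g(0)$. -/
lemma exists_leading_coeff {f : ℂ → 𝔸} {n : ℕ} (hf : AnalyticAt ℂ f 0)
    (hO : f =O[𝓝 0] fun z : ℂ => z ^ n) :
    ∃ D : 𝔸, (fun z => f z - z ^ n • D) =O[𝓝 0] fun z : ℂ => z ^ (n + 1) := by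
  have hord : (n : ℕ∞) ≤ analyticOrderAt f 0 := by
    -- If the order were $k<n$, then $f=z^kg$ with $g(0)\ne0$, whereas the bound forces
    -- $g=O(z^{n-k})\to0$.
    by_contra! hlt
    obtain ⟨k, hk⟩ := ENat.ne_top_iff_exists.mp hlt.ne_top
    rw [← hk, Nat.cast_lt] at hlt
    obtain ⟨g, hg, hg0, hfg⟩ := (hf.analyticOrderAt_eq_natCast).mp hk.symm
    simp only [sub_zero] at hfg
    have hlim : g =O[𝓝[≠] 0] fun z : ℂ => z ^ (n - k) := by
      obtain ⟨C, hC⟩ := hO.bound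
      refine IsBigO.of_bound C ?_
      filter_upwards [hC.filter_mono nhdsWithin_le_nhds, hfg.filter_mono nhdsWithin_le_nhds,
        self_mem_nhdsWithin] with z h1 h2 h3
      rw [h2, norm_smul, norm_pow, norm_pow] at h1
      have hz : 0 < ‖z‖ ^ k := pow_pos (norm_pos_iff.mpr h3) _
      rw [norm_pow]
      refine le_of_mul_le_mul_left (h1.trans_eq ?_) hz
      rw [show n = k + (n - k) by omega, pow_add, Nat.add_sub_cancel_left]
      ring
    have h0 : Tendsto g (𝓝[≠] 0) (𝓝 0) := by
      refine hlim.trans_tendsto ?_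
      have hc : Continuous fun z : ℂ => z ^ (n - k) := by fun_prop
      have := hc.tendsto 0
      rw [zero_pow (by omega)] at this
      exact this.mono_left nhdsWithin_le_nhds
    exact hg0 (tendsto_nhds_unique (hg.continuousAt.tendsto.mono_left nhdsWithin_le_nhds) h0)
  obtain ⟨g, hg, hfg⟩ := (natCast_le_analyticOrderAt hf).mp hord
  refine ⟨g 0, ?_⟩
  have h1 : (fun z => g z - g 0) =O[𝓝 0] fun z : ℂ => z := by
    simpa using hg.differentiableAt.isBigO_sub
  refine ((isBigO_refl (fun z : ℂ => z ^ n) _).smul h1).congr' ?_ ?_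
  · filter_upwards [hfg] with z hz
    rw [hz, sub_zero, smul_sub]
  · filter_upwards with z
    rw [smul_eq_mul, pow_succ]

lemma isBigO_pow_smul_const (n : ℕ) (D : 𝔸) :
    (fun z : ℂ => z ^ n • D) =O[𝓝 0] fun z : ℂ => z ^ n := by
  simpa using (isBigO_refl (fun z : ℂ => z ^ n) (𝓝 0)).smul
    (isBigO_const_const D (one_ne_zero (α := ℂ)) (𝓝 0))

end Asymptotics

/-! ### Words of exponentials and their inverses -/

section Words

variable {ι : Type*}

/-- Rescale all the coefficients of a word of exponentials. -/
def scaleWord (c : ℝ) (w : List (ι × ℝ)) : List (ι × ℝ) := w.map fun g => (g.1, c * g.2)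

/-- The word of the inverse product. -/
def invWord (w : List (ι × ℝ)) : List (ι × ℝ) := (scaleWord (-1) w).reverse

@[simp] lemma length_scaleWord (c : ℝ) (w : List (ι × ℝ)) :
    (scaleWord c w).length = w.length := by
  simp [scaleWord]

@[simp] lemma length_invWord (w : List (ι × ℝ)) : (invWord w).length = w.length := by
  simp [invWord]

lemma reverse_scaleWord (c : ℝ) (w : List (ι × ℝ)) :
    (scaleWord c w).reverse = scaleWord c w.reverse := by
  simp [scaleWord]

variable {𝔸 : Type*} [NormedRing 𝔸] [NormedAlgebra ℂ 𝔸]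

/-- The product of the exponentials `exp (c z X_i)` over the letters `(i, c)` of a word. -/
noncomputable def wordEval (X : ι → 𝔸) (w : List (ι × ℝ)) (z : ℂ) : 𝔸 :=
  (w.map fun g => NormedSpace.exp (((g.2 : ℂ) * z) • X g.1)).prod

variable (X : ι → 𝔸)

lemma wordEval_append (v w : List (ι × ℝ)) (z : ℂ) :
    wordEval X (v ++ w) z = wordEval X v z * wordEval X w z := by
  simp [wordEval]

lemma wordEval_scaleWord (c : ℝ) (w : List (ι × ℝ)) (z : ℂ) :
    wordEval X (scaleWord c w) z = wordEval X w (c * z) := by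
  simp only [wordEval, scaleWord, List.map_map, Function.comp_def, Complex.ofReal_mul]
  congr 2
  funext g
  congr 2
  ring

lemma wordEval_smul (r : ℂ) (w : List (ι × ℝ)) (z : ℂ) :
    wordEval (fun i => r • X i) w z = wordEval X w (r * z) := by
  simp only [wordEval, smul_smul]
  congr 2
  funext g
  congr 2
  ring

variable [CompleteSpace 𝔸]

lemma exp_add_smul (A : 𝔸) (a b : ℂ) :
    NormedSpace.exp ((a + b) • A) = NormedSpace.exp (a • A) * NormedSpace.exp (b • A) := by
  let _ : NormedAlgebra ℚ 𝔸 := NormedAlgebra.restrictScalars ℚ ℂ 𝔸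
  rw [add_smul, NormedSpace.exp_add_of_commute]
  exact ((Commute.refl A).smul_left a).smul_right b

lemma exp_neg_smul_mul (A : 𝔸) (a : ℂ) :
    NormedSpace.exp ((-a) • A) * NormedSpace.exp (a • A) = 1 := by
  rw [← exp_add_smul]; simp

lemma exp_mul_exp_neg_smul (A : 𝔸) (a : ℂ) :
    NormedSpace.exp (a • A) * NormedSpace.exp ((-a) • A) = 1 := by
  rw [← exp_add_smul]; simp

lemma wordEval_invWord_mul (w : List (ι × ℝ)) (z : ℂ) :
    wordEval X (invWord w) z * wordEval X w z = 1 := by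
  induction w with
  | nil => simp [wordEval, invWord, scaleWord]
  | cons g w ih =>
    have e1 : invWord (g :: w) = invWord w ++ [(g.1, -g.2)] := by simp [invWord, scaleWord]
    rw [e1, wordEval_append, show g :: w = [g] ++ w from rfl, wordEval_append, mul_assoc,
      ← mul_assoc (wordEval X [(g.1, -g.2)] z)]
    have : wordEval X [(g.1, -g.2)] z * wordEval X [g] z = 1 := by
      simp only [wordEval, List.map_cons, List.map_nil, List.prod_cons, List.prod_nil, mul_one,
        Complex.ofReal_neg, neg_mul]
      exact exp_neg_smul_mul _ _
    rw [this, one_mul, ih]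

/-- Time-reversal symmetry: for a palindrome, the inverse word is the word rescaled by $-1$. -/
lemma wordEval_neg_mul_of_palindrome {w : List (ι × ℝ)} (hw : w.reverse = w) (z : ℂ) :
    wordEval X w (-z) * wordEval X w z = 1 := by
  have h : invWord w = scaleWord (-1) w := by rw [invWord, reverse_scaleWord, hw]
  have := wordEval_invWord_mul X w z
  rwa [h, wordEval_scaleWord, Complex.ofReal_neg, Complex.ofReal_one, neg_one_mul] at this

lemma analyticAt_exp_smul (A : 𝔸) {u : ℂ → ℂ} {z : ℂ} (hu : AnalyticAt ℂ u z) :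
    AnalyticAt ℂ (fun z => NormedSpace.exp (u z • A)) z :=
  (NormedSpace.exp_analytic (𝕂 := ℂ) (u z • A)).comp_of_eq (hu.smul analyticAt_const) rfl

lemma analyticAt_wordEval (w : List (ι × ℝ)) (z : ℂ) : AnalyticAt ℂ (wordEval X w) z := by
  induction w with
  | nil => exact analyticAt_const
  | cons g w ih =>
    have : wordEval X (g :: w) = fun z =>
        NormedSpace.exp (((g.2 : ℂ) * z) • X g.1) * wordEval X w z := by
      funext z; simp [wordEval]
    rw [this]
    exact (analyticAt_exp_smul _ (analyticAt_const.mul analyticAt_id)).mul ih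

/-- First-order expansion of an exponential along a curve vanishing to order `m`. -/
lemma isBigO_exp_smul_sub (A : 𝔸) {m : ℕ} {u : ℂ → ℂ} (hu : u =O[𝓝 0] fun z : ℂ => z ^ m)
    (hu0 : Tendsto u (𝓝 0) (𝓝 0)) :
    (fun z => NormedSpace.exp (u z • A) - 1 - u z • A) =O[𝓝 0] fun z : ℂ => z ^ (2 * m) := by
  have hf : AnalyticAt ℂ (fun z : ℂ => NormedSpace.exp (z • A)) 0 :=
    analyticAt_exp_smul A analyticAt_id
  have hd : HasDerivAt (fun z : ℂ => NormedSpace.exp (z • A)) A 0 := by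
    have h := hasDerivAt_exp_smul_const (𝕂 := ℂ) A (0 : ℂ)
    simpa using h
  obtain ⟨D, hD⟩ := exists_leading_coeff (n := 1)
    (f := fun z : ℂ => NormedSpace.exp (z • A) - 1) (hf.sub analyticAt_const) (by
      simpa using hd.differentiableAt.isBigO_sub)
  -- Both are derivatives at $0$ of $z\mapsto e^{zA}$.
  have hDA : A = D := by
    refine hd.unique ?_
    rw [hasDerivAt_iff_isLittleO]
    have h2 : (fun z : ℂ => z ^ 2) =o[𝓝 0] fun z : ℂ => z := by
      simpa using isLittleO_pow_pow (𝕜 := ℂ) (m := 1) (n := 2) one_lt_two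
    simpa using hD.trans_isLittleO h2
  subst hDA
  have h3 := (hD.comp_tendsto hu0).trans (by simpa [Function.comp_def] using hu.pow 2)
  simpa [Function.comp_def, ← pow_mul, mul_comm] using h3

lemma isBigO_exp_smul_sub_one (A : 𝔸) {m : ℕ} {u : ℂ → ℂ}
    (hu : u =O[𝓝 0] fun z : ℂ => z ^ m) (hu0 : Tendsto u (𝓝 0) (𝓝 0)) :
    (fun z => NormedSpace.exp (u z • A) - 1) =O[𝓝 0] fun z : ℂ => z ^ m := by
  have h1 : (fun z => u z • A) =O[𝓝 0] fun z : ℂ => z ^ m := by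
    simpa using hu.smul (isBigO_const_const A (one_ne_zero (α := ℂ)) (𝓝 0))
  refine ((isBigO_pow_of_le (m := m) (by omega) (isBigO_exp_smul_sub A hu hu0)).add
    h1).congr_left fun z => ?_
  abel

end Words

/-! ### Order-raising recursions and their starting formulas -/

section Recursions

/-- With $q=4^{1/n}$ and $u=1/(4-q)$ one has $1-4u=-qu$; oddness of $n$ makes its $n$-th power
negative. -/
lemma exists_suzuki_coeff (n : ℕ) (hn : Odd n) (h1 : 2 ≤ n) :
    ∃ u : ℝ, 4 * u ^ n + (1 - 4 * u) ^ n = 0 := by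
  set q : ℝ := (4 : ℝ) ^ ((n : ℝ)⁻¹) with hq
  have hqn : q ^ n = 4 := Real.rpow_inv_natCast_pow (by norm_num) (by omega)
  have hq4 : 4 - q ≠ 0 := by
    intro h
    have h4 : q = 4 := by linarith
    rw [h4] at hqn
    have : (4 : ℝ) ^ 2 ≤ 4 ^ n := pow_le_pow_right₀ (by norm_num) h1
    rw [hqn] at this
    norm_num at this
  refine ⟨1 / (4 - q), ?_⟩
  have : 1 - 4 * (1 / (4 - q)) = -(q * (1 / (4 - q))) := by field_simp; ring
  rw [this, hn.neg_pow, mul_pow, hqn]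
  ring

/-- Take $b=qa$ with $q^{2m}=2$, then normalise $a$. This is possible because $q^2=2^{1/m}<2$ for
$m\ge2$. -/
lemma exists_commutator_coeffs (m : ℕ) (hm : 2 ≤ m) :
    ∃ a b : ℝ, 4 * a ^ 2 - 2 * b ^ 2 = 1 ∧ 4 * a ^ (2 * m) - 2 * b ^ (2 * m) = 0 := by
  set q : ℝ := (2 : ℝ) ^ (((2 * m : ℕ) : ℝ)⁻¹) with hq
  have hqn : q ^ (2 * m) = 2 := Real.rpow_inv_natCast_pow (by norm_num) (by omega)
  have hq2 : 0 < 4 - 2 * q ^ 2 := by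
    by_contra! h
    have h2 : (2 : ℝ) ≤ q ^ 2 := by linarith
    have h3 : (2 : ℝ) ^ m ≤ (q ^ 2) ^ m := pow_le_pow_left₀ (by norm_num) h2 m
    rw [← pow_mul, hqn] at h3
    have h4 : (2 : ℝ) ^ 2 ≤ 2 ^ m := pow_le_pow_right₀ (by norm_num) hm
    linarith
  refine ⟨√(1 / (4 - 2 * q ^ 2)), q * √(1 / (4 - 2 * q ^ 2)), ?_, ?_⟩
  · rw [mul_pow, Real.sq_sqrt (by positivity)]
    field_simp
  · rw [mul_pow, hqn]
    ring

variable {ι 𝔸 : Type*} [NormedRing 𝔸] [NormedAlgebra ℂ 𝔸] [CompleteSpace 𝔸] (X : ι → 𝔸)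

lemma tendsto_mul_pow_zero (c : ℂ) {m : ℕ} (hm : m ≠ 0) :
    Tendsto (fun z : ℂ => c * z ^ m) (𝓝 0) (𝓝 0) := by
  have : Continuous fun z : ℂ => c * z ^ m := by fun_prop
  simpa [hm] using this.tendsto 0

lemma isBigO_exp_pow_smul_sub_one (A : 𝔸) {m : ℕ} (hm : m ≠ 0) :
    (fun z : ℂ => NormedSpace.exp (z ^ m • A) - 1) =O[𝓝 0] fun z : ℂ => z ^ m :=
  isBigO_exp_smul_sub_one A (isBigO_refl _ _) (by simpa using tendsto_mul_pow_zero 1 hm)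

lemma isBigO_exp_mul_smul_sub_one (A : 𝔸) (c : ℂ) :
    (fun z : ℂ => NormedSpace.exp ((c * z) • A) - 1) =O[𝓝 0] fun z : ℂ => z ^ 1 :=
  isBigO_exp_smul_sub_one A (by simpa only [pow_one] using isBigO_const_mul_self c (fun z : ℂ => z) (𝓝 0))
    (by simpa using tendsto_mul_pow_zero c one_ne_zero)

lemma isBigO_exp_mul_smul_sub (A : 𝔸) (c : ℂ) :
    (fun z : ℂ => NormedSpace.exp ((c * z) • A) - 1 - (c * z) • A) =O[𝓝 0] fun z : ℂ => z ^ 2 :=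
  isBigO_exp_smul_sub A (m := 1)
    (by simpa only [pow_one] using isBigO_const_mul_self c (fun z : ℂ => z) (𝓝 0))
    (by simpa using tendsto_mul_pow_zero c one_ne_zero)

/-- Suzuki's fivefold recursion. -/
def suzukiWord (u : ℝ) (w : List (ι × ℝ)) : List (ι × ℝ) :=
  scaleWord u w ++ scaleWord u w ++ scaleWord (1 - 4 * u) w ++ scaleWord u w ++ scaleWord u w

lemma length_suzukiWord (u : ℝ) (w : List (ι × ℝ)) :
    (suzukiWord u w).length = 5 * w.length := by
  simp [suzukiWord]; ring

lemma reverse_suzukiWord (u : ℝ) {w : List (ι × ℝ)} (hw : w.reverse = w) :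
    (suzukiWord u w).reverse = suzukiWord u w := by
  simp [suzukiWord, reverse_scaleWord, hw]

/-- A palindromic product formula of odd order is correct to the next order. -/
lemma isBigO_succ_of_palindrome {w : List (ι × ℝ)} (hw : w.reverse = w) (H : 𝔸) {n : ℕ}
    (hn : Even n) (hn0 : n ≠ 0)
    (h : (fun z => wordEval X w z - NormedSpace.exp (z • H)) =O[𝓝 0] fun z : ℂ => z ^ n) :
    (fun z => wordEval X w z - NormedSpace.exp (z • H)) =O[𝓝 0] fun z : ℂ => z ^ (n + 1) := by
  have han : AnalyticAt ℂ (fun z => wordEval X w z - NormedSpace.exp (z • H)) 0 :=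
    (analyticAt_wordEval X w 0).sub (analyticAt_exp_smul H analyticAt_id)
  obtain ⟨D, hD⟩ := exists_leading_coeff han h
  have hP : Perturbs 1 n (wordEval X w) (fun z => NormedSpace.exp (z • H))
      (fun z => z ^ n • D) :=
    ⟨isBigO_pow_smul_const n D, by simpa using isBigO_exp_pow_smul_sub_one H one_ne_zero, hD⟩
  have h2 := ((hP.comp_mul (-1)).mul hP (by omega)).rest
  -- Time-reversal makes both products at $-z$ and $z$ equal to $1$, so the combined leading error
  -- $2z^nD$ ($n$ even) must itself be of higher order.
  have h3 : (fun z : ℂ => z ^ n • D) =O[𝓝 0] fun z : ℂ => z ^ (n + 1) := by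
    refine (h2.const_smul_left (-(1 / 2) : ℂ)).congr_left fun z => ?_
    rw [Pi.smul_apply, neg_one_mul, wordEval_neg_mul_of_palindrome X hw, exp_neg_smul_mul, hn.neg_pow]
    module
  refine (hD.add h3).congr_left fun z => ?_
  abel

/-- The five time fractions sum to $1$ and their $n$-th powers to $0$, so the leading error
disappears; the order $n+1$ reached is even, and the palindrome gives one more. -/
lemma isBigO_suzukiWord {w : List (ι × ℝ)} (hw : w.reverse = w) (H : 𝔸) {n : ℕ} (hn : Odd n)
    {u : ℝ} (hu : 4 * u ^ n + (1 - 4 * u) ^ n = 0)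
    (h : (fun z => wordEval X w z - NormedSpace.exp (z • H)) =O[𝓝 0] fun z : ℂ => z ^ n) :
    (fun z => wordEval X (suzukiWord u w) z - NormedSpace.exp (z • H)) =O[𝓝 0]
      fun z : ℂ => z ^ (n + 2) := by
  refine isBigO_succ_of_palindrome X (reverse_suzukiWord u hw) H hn.add_one (by omega) ?_
  have han : AnalyticAt ℂ (fun z => wordEval X w z - NormedSpace.exp (z • H)) 0 :=
    (analyticAt_wordEval X w 0).sub (analyticAt_exp_smul H analyticAt_id)
  obtain ⟨D, hD⟩ := exists_leading_coeff han h
  have hP : Perturbs 1 n (wordEval X w) (fun z => NormedSpace.exp (z • H))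
      (fun z => z ^ n • D) :=
    ⟨isBigO_pow_smul_const n D, by simpa using isBigO_exp_pow_smul_sub_one H one_ne_zero, hD⟩
  have h1 : 1 ≤ n := hn.pos
  have hu' := hP.comp_mul (u : ℂ)
  have hv := hP.comp_mul ((1 - 4 * u : ℝ) : ℂ)
  have h5 := ((((hu'.mul hu' h1).mul hv h1).mul hu' h1).mul hu' h1).rest
  refine h5.congr_left fun z => ?_
  have huC : 4 * (u : ℂ) ^ n + ((1 - 4 * u : ℝ) : ℂ) ^ n = 0 := by exact_mod_cast hu
  have hsum : ((u : ℂ) * z) ^ n • D + ((u : ℂ) * z) ^ n • D + (((1 - 4 * u : ℝ) : ℂ) * z) ^ n • D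
      + ((u : ℂ) * z) ^ n • D + ((u : ℂ) * z) ^ n • D = 0 := by
    have : ((u : ℂ) * z) ^ n + ((u : ℂ) * z) ^ n + (((1 - 4 * u : ℝ) : ℂ) * z) ^ n
      + ((u : ℂ) * z) ^ n + ((u : ℂ) * z) ^ n = 0 := by
      simp only [mul_pow]
      linear_combination z ^ n * huC
    simp only [← add_smul, this, zero_smul]
  rw [hsum, sub_zero]
  simp only [suzukiWord, wordEval_append, wordEval_scaleWord, ← exp_add_smul]
  congr 3
  push_cast
  ring

/-- By symmetry it suffices to match first-order terms: an $O(z^2)$ error is automatically $O(z^3)$.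
-/
lemma isBigO_strang (a b : ι) :
    (fun z => wordEval X [(a, 1 / 2), (b, 1), (a, 1 / 2)] z -
      NormedSpace.exp (z • (X a + X b))) =O[𝓝 0] fun z : ℂ => z ^ 3 := by
  refine isBigO_succ_of_palindrome X (by simp) _ (n := 2) even_two two_ne_zero ?_
  have key : ∀ (A : 𝔸) (c : ℂ), Perturbs 1 1 (fun z => NormedSpace.exp ((c * z) • A))
      (fun _ => 1) (fun z => (c * z) • A) := fun A c =>
    ⟨((isBigO_pow_smul_const 1 A).const_smul_left c).congr_left fun z => by
        rw [Pi.smul_apply, pow_one, mul_smul],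
      by simpa using isBigO_zero _ _, isBigO_exp_mul_smul_sub A c⟩
  have h3 := (((key (X a) (1 / 2)).mul (key (X b) 1) le_rfl).mul
    (key (X a) (1 / 2)) le_rfl).rest
  have h4 := (key (X a + X b) 1).rest
  refine (h3.sub h4).congr_left fun z => ?_
  simp only [wordEval, List.map_cons, List.map_nil, List.prod_cons, List.prod_nil, mul_one,
    one_mul, mul_assoc, Complex.ofReal_one, Complex.ofReal_div, Complex.ofReal_ofNat]
  module

variable (ι) in
/-- The threefold product and inverse pattern cancelling the two leading error terms of a
commutator formula. -/
def commutatorStep (a b : ℝ) (w : List (ι × ℝ)) : List (ι × ℝ) :=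
  scaleWord a w ++ scaleWord (-a) w ++ scaleWord b (invWord w) ++ scaleWord (-b) (invWord w) ++
    scaleWord a w ++ scaleWord (-a) w

lemma length_commutatorStep (a b : ℝ) (w : List (ι × ℝ)) :
    (commutatorStep ι a b w).length = 6 * w.length := by
  simp [commutatorStep]; ring

/-- Pairing $z$ with $-z$ cancels the error of odd degree $n$; the choice of $a,b$ cancels that of
degree $n+1$. Inverse words are needed because real rescalings multiply $z^2$ only by nonnegative
numbers. -/
lemma isBigO_commutatorStep {w : List (ι × ℝ)} (C : 𝔸) {n m : ℕ} (hnm : n + 1 = 2 * m)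
    (hn : 2 ≤ n) {a b : ℝ} (hab : 4 * a ^ 2 - 2 * b ^ 2 = 1)
    (hab' : 4 * a ^ (2 * m) - 2 * b ^ (2 * m) = 0)
    (h : (fun z => wordEval X w z - NormedSpace.exp (z ^ 2 • C)) =O[𝓝 0] fun z : ℂ => z ^ n) :
    (fun z => wordEval X (commutatorStep ι a b w) z - NormedSpace.exp (z ^ 2 • C)) =O[𝓝 0]
      fun z : ℂ => z ^ (n + 2) := by
  have hodd : Odd n := ⟨m - 1, by omega⟩
  have han : AnalyticAt ℂ (fun z => wordEval X w z - NormedSpace.exp (z ^ 2 • C)) 0 :=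
    (analyticAt_wordEval X w 0).sub (analyticAt_exp_smul C (analyticAt_id.pow 2))
  obtain ⟨D, hD⟩ := exists_leading_coeff han h
  obtain ⟨E, hE⟩ := exists_leading_coeff
    (f := fun z => wordEval X w z - NormedSpace.exp (z ^ 2 • C) - z ^ n • D)
    (han.sub ((analyticAt_id.pow n).smul analyticAt_const)) hD
  -- Two consecutive error coefficients can be tracked because the target $e^{z^2C}$ is already
  -- $1+O(z^2)$.
  have hP : Perturbs 2 n (wordEval X w) (fun z => NormedSpace.exp (z ^ 2 • C))
      (fun z => z ^ n • D + z ^ (n + 1) • E) := by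
    refine ⟨(isBigO_pow_smul_const n D).add (isBigO_pow_of_le (by omega)
      (isBigO_pow_smul_const (n + 1) E)), isBigO_exp_pow_smul_sub_one C two_ne_zero, ?_⟩
    refine hE.congr_left fun z => ?_
    abel
  have hQ := hP.inv hn (wordEval_invWord_mul X w)
    (W := fun z => NormedSpace.exp ((-z ^ 2) • C))
    (fun z => exp_neg_smul_mul C _) (fun z => exp_mul_exp_neg_smul C _)
    (isBigO_pow_zero (analyticAt_wordEval X _ 0).continuousAt)
    (isBigO_pow_zero (analyticAt_exp_smul C (analyticAt_id.pow 2).neg).continuousAt)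
  have h6 := ((((((hP.comp_mul a).mul (hP.comp_mul (-a : ℝ)) hn).mul
    (hQ.comp_mul b) hn).mul (hQ.comp_mul (-b : ℝ)) hn).mul (hP.comp_mul a) hn).mul
    (hP.comp_mul (-a : ℝ)) hn).rest
  refine h6.congr_left fun z => ?_
  have hab'C : 4 * (a : ℂ) ^ (n + 1) - 2 * (b : ℂ) ^ (n + 1) = 0 := by
    rw [hnm]; exact_mod_cast hab'
  have habC : 4 * (a : ℂ) ^ 2 - 2 * (b : ℂ) ^ 2 = 1 := by exact_mod_cast hab
  simp only [commutatorStep, wordEval_append, wordEval_scaleWord, ← exp_add_smul]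
  have e1 : ∀ c : ℝ, (((-c : ℝ) : ℂ) * z) ^ n = -((c * z) ^ n) := fun c => by
    rw [Complex.ofReal_neg, neg_mul, hodd.neg_pow]
  have e2 : ∀ c : ℝ, (((-c : ℝ) : ℂ) * z) ^ (n + 1) = (c * z) ^ (n + 1) := fun c => by
    rw [Complex.ofReal_neg, neg_mul, hodd.add_one.neg_pow]
  simp only [e1, e2]
  have e3 : ((a : ℂ) * z) ^ 2 + (((-a : ℝ) : ℂ) * z) ^ 2 + -((b : ℂ) * z) ^ 2 +
      -(((-b : ℝ) : ℂ) * z) ^ 2 + ((a : ℂ) * z) ^ 2 + (((-a : ℝ) : ℂ) * z) ^ 2 = z ^ 2 := by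
    push_cast
    linear_combination z ^ 2 * habC
  rw [e3, sub_eq_self]
  have e4 : (4 * ((a : ℂ) * z) ^ (n + 1) - 2 * ((b : ℂ) * z) ^ (n + 1)) = 0 := by
    simp only [mul_pow]
    linear_combination z ^ (n + 1) * hab'C
  calc _ = (4 * ((a : ℂ) * z) ^ (n + 1) - 2 * ((b : ℂ) * z) ^ (n + 1)) • E := by module
    _ = 0 := by rw [e4, zero_smul]

/-- The group commutator of two one-parameter groups. -/
lemma isBigO_groupCommutator (a b : ι) :
    (fun z => wordEval X [(a, 1), (b, 1), (a, -1), (b, -1)] z -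
      NormedSpace.exp (z ^ 2 • (X a * X b - X b * X a))) =O[𝓝 0] fun z : ℂ => z ^ 3 := by
  set A := X a
  set B := X b
  set P : ℂ → 𝔸 := fun z => NormedSpace.exp (z • A)
  set Q : ℂ → 𝔸 := fun z => NormedSpace.exp (z • B)
  set P' : ℂ → 𝔸 := fun z => NormedSpace.exp ((-z) • A)
  set Q' : ℂ → 𝔸 := fun z => NormedSpace.exp ((-z) • B)
  have hA1 : (fun z => P z - 1) =O[𝓝 0] fun z : ℂ => z ^ 1 := by
    simpa using isBigO_exp_mul_smul_sub_one A 1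
  have hB1 : (fun z => Q z - 1) =O[𝓝 0] fun z : ℂ => z ^ 1 := by
    simpa using isBigO_exp_mul_smul_sub_one B 1
  have hA1' : (fun z => P' z - 1) =O[𝓝 0] fun z : ℂ => z ^ 1 := by
    simpa only [neg_one_mul] using isBigO_exp_mul_smul_sub_one A (-1)
  have hB1' : (fun z => Q' z - 1) =O[𝓝 0] fun z : ℂ => z ^ 1 := by
    simpa only [neg_one_mul] using isBigO_exp_mul_smul_sub_one B (-1)
  have hA2 : (fun z => P z - 1 - z • A) =O[𝓝 0] fun z : ℂ => z ^ 2 := by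
    simpa using isBigO_exp_mul_smul_sub A 1
  have hB2 : (fun z => Q z - 1 - z • B) =O[𝓝 0] fun z : ℂ => z ^ 2 := by
    simpa using isBigO_exp_mul_smul_sub B 1
  have hA : (fun z : ℂ => z • A) =O[𝓝 0] fun z : ℂ => z ^ 1 := by
    simpa using isBigO_pow_smul_const 1 A
  have hB : (fun z : ℂ => z • B) =O[𝓝 0] fun z : ℂ => z ^ 1 := by
    simpa using isBigO_pow_smul_const 1 B
  -- Expanding $PQ-QP$ needs no second-order terms of the exponentials; multiplying by
  -- $(QP)^{-1}=P'Q'$ then yields the group commutator minus $1$.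
  have hcomm : (fun z => P z * Q z - Q z * P z - z ^ 2 • (A * B - B * A)) =O[𝓝 0]
      fun z : ℂ => z ^ 3 := by
    refine (((isBigO_pow_mul (k := 3) (by omega) hA2 hB1).add
      (isBigO_pow_mul (k := 3) (by omega) hA hB2)).sub
      ((isBigO_pow_mul (k := 3) (by omega) hB2 hA1).add
      (isBigO_pow_mul (k := 3) (by omega) hB hA2))).congr_left fun z => ?_
    have e : z ^ 2 • (A * B - B * A) = z • A * z • B - z • B * z • A := by
      simp only [smul_mul_assoc, mul_smul_comm, smul_smul, smul_sub, pow_two]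
    rw [e]
    generalize z • A = A', z • B = B'
    noncomm_ring
  have hPQ' : (fun z => P' z * Q' z - 1) =O[𝓝 0] fun z : ℂ => z ^ 1 := by
    refine (((isBigO_pow_mul (k := 1) (by omega) hA1' hB1').add hA1').add hB1').congr_left
      fun z => ?_
    noncomm_ring
  have hC2 : (fun z : ℂ => z ^ 2 • (A * B - B * A)) =O[𝓝 0] fun z : ℂ => z ^ 2 :=
    isBigO_pow_smul_const 2 _
  have hb : (fun z => P' z * Q' z) =O[𝓝 0] fun z : ℂ => z ^ 0 := by
    simpa using (isBigO_pow_of_le (Nat.zero_le _) hPQ').add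
      (isBigO_pow_zero (f := fun _ => (1 : 𝔸)) continuousAt_const)
  have hexp : (fun z : ℂ => NormedSpace.exp (z ^ 2 • (A * B - B * A)) - 1 -
      z ^ 2 • (A * B - B * A)) =O[𝓝 0] fun z : ℂ => z ^ 3 :=
    isBigO_pow_of_le (by omega) (isBigO_exp_smul_sub (A * B - B * A) (isBigO_refl _ _)
      (by simpa using tendsto_mul_pow_zero 1 two_ne_zero))
  refine (((isBigO_pow_mul (k := 3) (by omega) hcomm hb).add
    (isBigO_pow_mul (k := 3) (by omega) hC2 hPQ')).sub hexp).congr_left fun z => ?_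
  have hw : wordEval X [(a, 1), (b, 1), (a, -1), (b, -1)] z = P z * Q z * (P' z * Q' z) := by
    simp [wordEval, P, Q, P', Q', A, B, mul_assoc]
  have hinv : Q z * P z * (P' z * Q' z) = 1 := by
    rw [mul_assoc, ← mul_assoc (P z), exp_mul_exp_neg_smul, one_mul, exp_mul_exp_neg_smul]
  rw [hw, sub_mul, sub_mul, hinv, mul_sub, mul_one]
  abel

end Recursions

/-! ### Universal words of every order -/

section Existence

variable {ι : Type}

/-- Symmetric product formulas of every even order, with the number of exponentials of Suzuki's
recursion. -/
lemma exists_symmetric_word (a b : ι) (k : ℕ) :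
    ∃ w : List (ι × ℝ), w.length = 3 * 5 ^ k ∧ w.reverse = w ∧
      ∀ (𝔸 : Type) [NormedRing 𝔸] [NormedAlgebra ℂ 𝔸] [CompleteSpace 𝔸] (X : ι → 𝔸),
        (fun z => wordEval X w z - NormedSpace.exp (z • (X a + X b))) =O[𝓝 0]
          fun z : ℂ => z ^ (2 * k + 3) := by
  induction k with
  | zero => exact ⟨_, by simp, by simp, fun 𝔸 _ _ _ X => isBigO_strang X a b⟩
  | succ k ih =>
    obtain ⟨w, hlen, hrev, hw⟩ := ih
    have hodd : Odd (2 * k + 3) := ⟨k + 1, by ring⟩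
    obtain ⟨u, hu⟩ := exists_suzuki_coeff (2 * k + 3) hodd (by omega)
    refine ⟨suzukiWord u w, ?_, reverse_suzukiWord u hrev, fun 𝔸 _ _ _ X =>
      isBigO_suzukiWord X hrev _ hodd hu (hw 𝔸 X)⟩
    rw [length_suzukiWord, hlen]
    ring

/-- Product formulas of every order for the exponential of a commutator. -/
lemma exists_commutator_word (a b : ι) (k : ℕ) :
    ∃ w : List (ι × ℝ), w.length = 4 * 6 ^ k ∧
      ∀ (𝔸 : Type) [NormedRing 𝔸] [NormedAlgebra ℂ 𝔸] [CompleteSpace 𝔸] (X : ι → 𝔸),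
        (fun z => wordEval X w z - NormedSpace.exp (z ^ 2 • (X a * X b - X b * X a))) =O[𝓝 0]
          fun z : ℂ => z ^ (2 * k + 3) := by
  induction k with
  | zero => exact ⟨_, by simp, fun 𝔸 _ _ _ X => isBigO_groupCommutator X a b⟩
  | succ k ih =>
    obtain ⟨w, hlen, hw⟩ := ih
    obtain ⟨c, d, h1, h2⟩ := exists_commutator_coeffs (k + 2) (by omega)
    refine ⟨commutatorStep ι c d w, ?_, fun 𝔸 _ _ _ X =>
      isBigO_commutatorStep X _ (by ring) (by omega) h1 h2 (hw 𝔸 X)⟩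
    rw [length_commutatorStep, hlen]
    ring

end Existence

/-! ### Constants uniform over a family of Banach algebras -/

section Uniform

open scoped ENNReal

variable {κ : Type} {𝔸 : κ → Type} [∀ k, NormedRing (𝔸 k)] {ι : Type}

variable (κ 𝔸 ι) in
/-- The index of a normalised family of generators. -/
abbrev UnitFamily : Type := Σ k : κ, {X : ι → 𝔸 k // ∀ i, ‖X i‖ ≤ 1}

variable (κ 𝔸) in
/-- The universal normalised family of generators, in the algebra of bounded families. -/
noncomputable def universalFamily (i : ι) : lp (fun q : UnitFamily κ 𝔸 ι => 𝔸 q.1) ∞ :=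
  ⟨fun q => q.2.1 i, memℓp_infty ⟨1, by rintro _ ⟨q, rfl⟩; exact q.2.2 i⟩⟩

/-- Every family of generators of norm at most `r` is `r` times a normalised one. -/
lemma exists_unitFamily [∀ k, NormedAlgebra ℂ (𝔸 k)] {k : κ} (X : ι → 𝔸 k) {r : ℝ} (hr : 0 ≤ r) (hX : ∀ i, ‖X i‖ ≤ r) :
    ∃ q : UnitFamily κ 𝔸 ι, ∃ h : q.1 = k, ∀ i, X i = (r : ℂ) • (h ▸ q.2.1 i : 𝔸 k) := by
  refine ⟨⟨k, fun i => (r : ℂ)⁻¹ • X i, fun i => ?_⟩, rfl, fun i => ?_⟩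
  · rw [norm_smul, norm_inv, Complex.norm_real, Real.norm_of_nonneg hr]
    exact inv_mul_le_one_of_le₀ (hX i) hr
  -- For $r=0$ the normalised family uses $0^{-1}=0$, and all generators vanish anyway.
  · rcases hr.eq_or_lt with h | h
    · have : X i = 0 := norm_le_zero_iff.mp ((hX i).trans_eq h.symm)
      simp [this]
    · have : (r : ℂ) ≠ 0 := by exact_mod_cast h.ne'
      simp [smul_smul, this]

variable [∀ k, NormOneClass (𝔸 k)]

/-- Evaluation of a bounded family at one index. -/
def lpEval (k : κ) : lp 𝔸 ∞ →+* 𝔸 k where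
  toFun f := f k
  map_one' := by simp [lp.infty_coeFn_one]
  map_mul' f g := by simp [lp.infty_coeFn_mul]
  map_zero' := rfl
  map_add' _ _ := rfl

lemma norm_lpEval_le (k : κ) (f : lp 𝔸 ∞) : ‖lpEval k f‖ ≤ ‖f‖ :=
  lp.norm_apply_le_norm ENNReal.top_ne_zero f k

lemma lpEval_universalFamily (q : UnitFamily κ 𝔸 ι) (i : ι) :
    lpEval q (universalFamily κ 𝔸 i) = q.2.1 i := rfl

variable [∀ k, NormedAlgebra ℂ (𝔸 k)]

lemma lpEval_smul (k : κ) (c : ℂ) (f : lp 𝔸 ∞) : lpEval k (c • f) = c • lpEval k f := rfl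

variable [∀ k, CompleteSpace (𝔸 k)]

lemma lpEval_exp (k : κ) (f : lp 𝔸 ∞) :
    lpEval k (NormedSpace.exp f) = NormedSpace.exp (lpEval k f) := by
  let _ : NormedAlgebra ℚ (lp 𝔸 ∞) := NormedAlgebra.restrictScalars ℚ ℂ _
  let _ : NormedAlgebra ℚ (𝔸 k) := NormedAlgebra.restrictScalars ℚ ℂ _
  exact NormedSpace.map_exp (lpEval k)
    (AddMonoidHomClass.continuous_of_bound (lpEval k) 1 fun f => by
      simpa using norm_lpEval_le k f) f

lemma lpEval_wordEval (k : κ) (Y : ι → lp 𝔸 ∞) (w : List (ι × ℝ)) (z : ℂ) :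
    lpEval k (wordEval Y w z) = wordEval (fun i => lpEval k (Y i)) w z := by
  simp [wordEval, map_list_prod, Function.comp_def, lpEval_exp, lpEval_smul]

lemma exists_bound_of_isBigO {E : Type*} [NormedAddCommGroup E] {f : ℂ → E} {n : ℕ} (h : f =O[𝓝 0] fun z : ℂ => z ^ n) :
    ∃ K δ : ℝ, 0 < δ ∧ ∀ z : ℂ, ‖z‖ < δ → ‖f z‖ ≤ K * ‖z‖ ^ n := by
  obtain ⟨K, hK⟩ := h.bound
  obtain ⟨δ, hδ, hb⟩ := Metric.eventually_nhds_iff.mp hK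
  refine ⟨K, δ, hδ, fun z hz => ?_⟩
  simpa using hb (by simpa using hz)

/-- An error that is at most `2`, and `O(x ^ n)` for small `x`, is `O(x ^ q)` for all `x ≥ 0`. -/
lemma exists_global_bound (K₀ δ q : ℝ) (n : ℕ) (hδ : 0 < δ) (hq : 0 ≤ q) (hqn : q ≤ n) :
    ∃ K : ℝ, 0 ≤ K ∧ ∀ x e : ℝ, 0 ≤ x → e ≤ 2 → (x < δ → e ≤ K₀ * x ^ n) → e ≤ K * x ^ q := by
  have hm : 0 < min δ 1 := lt_min hδ one_pos
  refine ⟨max |K₀| (2 / min δ 1 ^ q), le_max_of_le_left (abs_nonneg _),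
    fun x e hx he2 he => ?_⟩
  have hxq : 0 ≤ x ^ q := Real.rpow_nonneg hx q
  -- Below $1$ the power $x^n$ is dominated by $x^q$, as $q\le n$; above the threshold the trivial
  -- bound $2$ is absorbed into the constant.
  rcases lt_or_ge x (min δ 1) with h | h
  · have h1 : x ^ n ≤ x ^ q := by
      rw [← Real.rpow_natCast]
      exact Real.rpow_le_rpow_of_exponent_ge' hx (h.le.trans (min_le_right _ _)) hq hqn
    calc e ≤ K₀ * x ^ n := he (h.trans_le (min_le_left _ _))
      _ ≤ |K₀| * x ^ q := mul_le_mul (le_abs_self _) h1 (by positivity) (abs_nonneg _)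
      _ ≤ _ := mul_le_mul_of_nonneg_right (le_max_left _ _) hxq
  · have h1 : min δ 1 ^ q ≤ x ^ q := Real.rpow_le_rpow hm.le h hq
    have h2 : 0 < min δ 1 ^ q := Real.rpow_pos_of_pos hm q
    calc e ≤ 2 := he2
      _ = 2 / min δ 1 ^ q * min δ 1 ^ q := by field_simp
      _ ≤ 2 / min δ 1 ^ q * x ^ q := mul_le_mul_of_nonneg_left h1 (by positivity)
      _ ≤ _ := mul_le_mul_of_nonneg_right (le_max_right _ _) hxq

variable (κ 𝔸) in
-- The radius and constant found for `universalFamily` serve all members at once. Generators $rY$ at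
-- time $t$ act as $Y$ at time $rt$, hence the variable $r|t|$.
lemma exists_uniform_symmetric_bound {w : List (ι × ℝ)} {a b : ι} {n : ℕ}
    (hw : ∀ (𝔸 : Type) [NormedRing 𝔸] [NormedAlgebra ℂ 𝔸] [CompleteSpace 𝔸] (X : ι → 𝔸),
        (fun z => wordEval X w z - NormedSpace.exp (z • (X a + X b))) =O[𝓝 0]
          fun z : ℂ => z ^ n) {q : ℝ} (hq : 0 ≤ q) (hqn : q ≤ n) :
    ∃ K : ℝ, 0 ≤ K ∧ ∀ (k : κ) (X : ι → 𝔸 k) (r t : ℝ), 0 ≤ r → (∀ i, ‖X i‖ ≤ r) →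
      ‖wordEval X w t - NormedSpace.exp ((t : ℂ) • (X a + X b))‖ ≤ 2 →
      ‖wordEval X w t - NormedSpace.exp ((t : ℂ) • (X a + X b))‖ ≤ K * (r * |t|) ^ q := by
  obtain ⟨K₀, δ, hδ, hb⟩ := exists_bound_of_isBigO (hw _ (universalFamily κ 𝔸))
  obtain ⟨K, hK, hbound⟩ := exists_global_bound K₀ δ q n hδ hq hqn
  refine ⟨K, hK, fun k X r t hr hX h2 => hbound _ _ (by positivity) h2 fun hlt => ?_⟩
  obtain ⟨v, rfl, hv⟩ := exists_unitFamily X hr hX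
  obtain rfl : X = fun i => (r : ℂ) • v.2.1 i := funext hv
  have hnorm : ‖((r * t : ℝ) : ℂ)‖ = r * |t| := by
    rw [Complex.norm_real, norm_mul, Real.norm_of_nonneg hr, Real.norm_eq_abs]
  have h := (norm_lpEval_le v _).trans (hb ((r * t : ℝ) : ℂ) (by rwa [hnorm]))
  rw [hnorm, map_sub, lpEval_wordEval, lpEval_exp, lpEval_smul, map_add] at h
  simp only [lpEval_universalFamily] at h
  rw [wordEval_smul, ← smul_add, smul_smul, mul_comm (t : ℂ)]
  simpa only [Complex.ofReal_mul] using h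

variable (κ 𝔸) in
lemma exists_uniform_commutator_bound {w : List (ι × ℝ)} {a b : ι} {n : ℕ}
    (hw : ∀ (𝔸 : Type) [NormedRing 𝔸] [NormedAlgebra ℂ 𝔸] [CompleteSpace 𝔸] (X : ι → 𝔸),
        (fun z => wordEval X w z - NormedSpace.exp (z ^ 2 • (X a * X b - X b * X a))) =O[𝓝 0]
          fun z : ℂ => z ^ n) :
    ∃ K : ℝ, 0 ≤ K ∧ ∀ (k : κ) (X : ι → 𝔸 k) (r t : ℝ), 0 ≤ r → (∀ i, ‖X i‖ ≤ r) →
      ‖wordEval X w t - NormedSpace.exp ((t : ℂ) ^ 2 • (X a * X b - X b * X a))‖ ≤ 2 →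
      ‖wordEval X w t - NormedSpace.exp ((t : ℂ) ^ 2 • (X a * X b - X b * X a))‖ ≤
        K * (r * |t|) ^ (n : ℝ) := by
  obtain ⟨K₀, δ, hδ, hb⟩ := exists_bound_of_isBigO (hw _ (universalFamily κ 𝔸))
  obtain ⟨K, hK, hbound⟩ := exists_global_bound K₀ δ n n hδ n.cast_nonneg le_rfl
  refine ⟨K, hK, fun k X r t hr hX h2 => hbound _ _ (by positivity) h2 fun hlt => ?_⟩
  obtain ⟨v, rfl, hv⟩ := exists_unitFamily X hr hX
  obtain rfl : X = fun i => (r : ℂ) • v.2.1 i := funext hv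
  have hnorm : ‖((r * t : ℝ) : ℂ)‖ = r * |t| := by
    rw [Complex.norm_real, norm_mul, Real.norm_of_nonneg hr, Real.norm_eq_abs]
  have h := (norm_lpEval_le v _).trans (hb ((r * t : ℝ) : ℂ) (by rwa [hnorm]))
  rw [hnorm, map_sub, lpEval_wordEval, lpEval_exp, lpEval_smul, map_sub, map_mul, map_mul] at h
  simp only [lpEval_universalFamily] at h
  -- The commutator is quadratic in the generators, which matches the scaling of $t^2$.
  have e : ∀ x y : 𝔸 v.1, (t : ℂ) ^ 2 • ((r : ℂ) • x * (r : ℂ) • y - (r : ℂ) • y * (r : ℂ) • x) =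
      ((r * t : ℝ) : ℂ) ^ 2 • (x * y - y * x) := fun x y => by
    simp only [smul_mul_assoc, mul_smul_comm, smul_smul, ← smul_sub, Complex.ofReal_mul]
    congr 1
    ring
  rw [wordEval_smul, e]
  simpa only [Complex.ofReal_mul] using h

end Uniform

/-! ### Unitarity, Kronecker norms and Pauli matrices -/

section Matrices

open Matrix

lemma isHermitian_kronecker {m n : Type*} {A : Matrix m m ℂ} {B : Matrix n n ℂ} (hA : A.IsHermitian)
    (hB : B.IsHermitian) : (A ⊗ₖ B).IsHermitian := by
  rw [IsHermitian, conjTranspose_kronecker, hA.eq, hB.eq]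

variable {m n : Type} [Fintype m] [DecidableEq m] [Fintype n] [DecidableEq n]

lemma norm_le_one_of_mem_unitary {U : Matrix n n ℂ} (hU : U ∈ unitary (Matrix n n ℂ)) :
    ‖U‖ ≤ 1 := by
  rcases subsingleton_or_nontrivial (Matrix n n ℂ) with h | h
  · simp [Subsingleton.elim U 0]
  · exact (CStarRing.norm_of_mem_unitary hU).le

lemma norm_exp_I_smul_le_one {H : Matrix n n ℂ} (hH : H.IsHermitian) (t : ℝ) :
    ‖NormedSpace.exp ((Complex.I * (t : ℂ)) • H)‖ ≤ 1 := by
  have hsa : IsSelfAdjoint ((t : ℂ) • H) := by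
    rw [isSelfAdjoint_iff, star_smul, star_eq_conjTranspose, hH.eq]
    simp
  have hu := (selfAdjoint.expUnitary ⟨(t : ℂ) • H, hsa⟩).2
  rw [selfAdjoint.expUnitary_coe] at hu
  rw [mul_smul]
  exact norm_le_one_of_mem_unitary hu

/-- The `⋆`-homomorphism `A ↦ 1 ⊗ A`. -/
def oneKroneckerHom (m n : Type) [Fintype m] [DecidableEq m] [Fintype n] [DecidableEq n] :
    Matrix n n ℂ →⋆ₙₐ[ℂ] Matrix (m × n) (m × n) ℂ where
  toFun A := (1 : Matrix m m ℂ) ⊗ₖ A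
  map_smul' c A := by simp [kronecker_smul]
  map_zero' := by simp
  map_add' A B := kronecker_add _ _ _
  map_mul' A B := by rw [← mul_kronecker_mul, one_mul]
  map_star' A := by simp [star_eq_conjTranspose, conjTranspose_kronecker]

/-- $U\otimes A=(U\otimes1)(1\otimes A)$: the first factor is unitary, and the second is the image
of $A$ under a $\star$-homomorphism, hence contractive. -/
lemma norm_kronecker_le_of_mem_unitary {U : Matrix m m ℂ} (hU : U ∈ unitary (Matrix m m ℂ))
    (A : Matrix n n ℂ) : ‖U ⊗ₖ A‖ ≤ ‖A‖ := by
  have h1 : U ⊗ₖ A = U ⊗ₖ (1 : Matrix n n ℂ) * (1 : Matrix m m ℂ) ⊗ₖ A := by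
    rw [← mul_kronecker_mul, mul_one, one_mul]
  have h2 : U ⊗ₖ (1 : Matrix n n ℂ) ∈ unitary (Matrix (m × n) (m × n) ℂ) := by
    rw [Unitary.mem_iff] at hU ⊢
    simp only [star_eq_conjTranspose, conjTranspose_kronecker, ← mul_kronecker_mul,
      conjTranspose_one, mul_one] at hU ⊢
    simp [hU.1, hU.2]
  rw [h1]
  refine (norm_mul_le _ _).trans ?_
  have h3 := norm_le_one_of_mem_unitary h2
  have h4 : ‖(1 : Matrix m m ℂ) ⊗ₖ A‖ ≤ ‖A‖ :=
    NonUnitalStarAlgHom.norm_apply_le (oneKroneckerHom m n) A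
  nlinarith [norm_nonneg ((1 : Matrix m m ℂ) ⊗ₖ A)]

lemma pauli_isHermitian (a : Axis) : (pauli a).IsHermitian := by
  ext i j
  cases a <;> fin_cases i <;> fin_cases j <;> simp [pauli]

lemma pauli_mem_unitary (a : Axis) : pauli a ∈ unitary (Matrix (Fin 2) (Fin 2) ℂ) := by
  have h : pauli a * pauli a = 1 := by
    ext i j
    cases a <;> fin_cases i <;> fin_cases j <;> simp [pauli]
  rw [Unitary.mem_iff, star_eq_conjTranspose, (pauli_isHermitian a).eq]
  exact ⟨h, h⟩

lemma pauli_commutator :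
    pauli .z * pauli .y - pauli .y * pauli .z = (-2 * Complex.I) • pauli .x := by
  ext i j
  fin_cases i <;> fin_cases j <;> simp [pauli] <;> ring

lemma norm_pauli_kronecker_le (a : Axis) (A : Matrix n n ℂ) : ‖pauli a ⊗ₖ A‖ ≤ ‖A‖ :=
  norm_kronecker_le_of_mem_unitary (pauli_mem_unitary a) A

lemma blockEncoding_of_isHermitian {A : Matrix n n ℂ} (hA : A.IsHermitian) (t : ℝ) :
    blockEncoding A t = NormedSpace.exp ((Complex.I * (t : ℂ)) • (pauli .x ⊗ₖ A)) := by
  have : pauli .x = !![0, 1; 0, 0] + !![0, 0; 1, 0] := by simp [pauli]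
  rw [blockEncoding, hA.eq, this, add_kronecker]

lemma norm_blockEncoding_le_one {A : Matrix n n ℂ} (hA : A.IsHermitian) (t : ℝ) :
    ‖blockEncoding A t‖ ≤ 1 := by
  rw [blockEncoding_of_isHermitian hA]
  exact norm_exp_I_smul_le_one (isHermitian_kronecker (pauli_isHermitian _) hA) t

end Matrices

/-! ### Generators of the gates and of the block encodings -/

section Modes

open Matrix

variable (Λ₁ Λ₂ : ℕ)

lemma quadrature_isHermitian (Λ : ℕ) (Q : Quadrature) : (quadrature Λ Q).IsHermitian := by
  cases Q
  · simp [quadrature, position, IsHermitian, conjTranspose_smul, add_comm]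
  · simp only [quadrature, momentum, IsHermitian, conjTranspose_smul, conjTranspose_sub,
      conjTranspose_conjTranspose]
    rw [← neg_sub, smul_neg, ← neg_smul]
    congr 1
    simp [neg_div]

lemma modeOp_isHermitian (Q : Quadrature) (m : Mode) : (modeOp Λ₁ Λ₂ Q m).IsHermitian := by
  cases m
  · exact isHermitian_kronecker (quadrature_isHermitian _ _) isHermitian_one
  · exact isHermitian_kronecker isHermitian_one (quadrature_isHermitian _ _)

lemma modeOp_commute (Q : Quadrature) :
    modeOp Λ₁ Λ₂ Q .two * modeOp Λ₁ Λ₂ Q .one = quadProduct Λ₁ Λ₂ Q := by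
  simp only [quadProduct, modeOp, ← mul_kronecker_mul, one_mul, mul_one]

lemma quadProduct_isHermitian (Q : Quadrature) : (quadProduct Λ₁ Λ₂ Q).IsHermitian := by
  rw [IsHermitian, quadProduct, conjTranspose_mul, (modeOp_isHermitian _ _ _ _).eq,
    (modeOp_isHermitian _ _ _ _).eq, modeOp_commute, quadProduct]

lemma beamSplitterOp_isHermitian : (beamSplitterOp Λ₁ Λ₂).IsHermitian :=
  (quadProduct_isHermitian _ _ _).add (quadProduct_isHermitian _ _ _)

lemma quadConst_nonneg (Q : Quadrature) : 0 ≤ quadConst Λ₁ Λ₂ Q :=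
  le_max_of_le_left (by positivity)

lemma norm_modeOp_le (Q : Quadrature) (m : Mode) :
    ‖modeOp Λ₁ Λ₂ Q m‖ ≤ √(quadConst Λ₁ Λ₂ Q) := by
  refine Real.le_sqrt_of_sq_le ?_
  cases m
  · exact le_max_left _ _
  · exact le_max_right _ _

lemma quadConst_le (Q : Quadrature) : quadConst Λ₁ Λ₂ Q ≤ beamSplitterConst Λ₁ Λ₂ := by
  refine le_max_of_le_right ?_
  cases Q
  · exact le_max_left _ _
  · exact le_max_right _ _

lemma norm_quadProduct_le (Q : Quadrature) : ‖quadProduct Λ₁ Λ₂ Q‖ ≤ quadConst Λ₁ Λ₂ Q :=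
  calc ‖quadProduct Λ₁ Λ₂ Q‖ ≤ √(quadConst Λ₁ Λ₂ Q) * √(quadConst Λ₁ Λ₂ Q) :=
        (norm_mul_le _ _).trans (mul_le_mul (norm_modeOp_le _ _ _ _) (norm_modeOp_le _ _ _ _)
          (norm_nonneg _) (Real.sqrt_nonneg _))
    _ = quadConst Λ₁ Λ₂ Q := Real.mul_self_sqrt (quadConst_nonneg _ _ _)

lemma norm_gate_eval_le_one (g : Gate) : ‖g.eval Λ₁ Λ₂‖ ≤ 1 :=
  norm_exp_I_smul_le_one (isHermitian_kronecker (pauli_isHermitian _)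
    (modeOp_isHermitian _ _ _ _)) _

lemma norm_list_prod_le_one {R : Type*} [NormedRing R] [NormOneClass R] {l : List R}
    (h : ∀ a ∈ l, ‖a‖ ≤ 1) : ‖l.prod‖ ≤ 1 := by
  induction l with
  | nil => simp
  | cons a l ih =>
    rw [List.prod_cons]
    exact (norm_mul_le _ _).trans (mul_le_one₀ (h a (by simp)) (norm_nonneg _)
      (ih fun b hb => h b (by simp [hb])))

lemma norm_circuit_eval_le_one (c : Circuit) : ‖c.eval Λ₁ Λ₂‖ ≤ 1 := by
  refine norm_list_prod_le_one fun a ha => ?_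
  obtain ⟨g, -, rfl⟩ := List.mem_map.mp ha
  exact norm_gate_eval_le_one _ _ g

lemma norm_sub_le_two {E : Type*} [SeminormedAddCommGroup E] {a b : E} (ha : ‖a‖ ≤ 1)
    (hb : ‖b‖ ≤ 1) : ‖a - b‖ ≤ 2 :=
  (norm_sub_le a b).trans (by linarith)

/-- The gates of a synthesized exponential act along `σ^z` on mode one, `σ^y` on mode two. -/
def modeAxis : Mode → Axis
  | .one => .z
  | .two => .y

/-- The sign of the requested angle is carried by the gates on mode two. -/
noncomputable def modeSign (s : ℝ) : Mode → ℝ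
  | .one => 1
  | .two => SignType.sign s

/-- The circuit approximating the block encoding of `x̂₁ x̂₂` or `p̂₁ p̂₂`, obtained from a product
formula for commutators. -/
noncomputable def synthCircuit (w : List (Mode × ℝ)) (Q : Quadrature) (s : ℝ) : Circuit :=
  w.map fun g => ⟨Q, g.1, modeAxis g.1, modeSign s g.1 * (g.2 * √(|s| / 2))⟩

/-- The anti-Hermitian generators of the gates of `synthCircuit`. -/
noncomputable def gateGenerator (Q : Quadrature) (s : ℝ) (m : Mode) :
    Matrix (Hybrid Λ₁ Λ₂) (Hybrid Λ₁ Λ₂) ℂ :=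
  (Complex.I * (modeSign s m : ℂ)) • (pauli (modeAxis m) ⊗ₖ modeOp Λ₁ Λ₂ Q m)

lemma eval_synthCircuit (w : List (Mode × ℝ)) (Q : Quadrature) (s : ℝ) :
    (synthCircuit w Q s).eval Λ₁ Λ₂ =
      wordEval (gateGenerator Λ₁ Λ₂ Q s) w ((√(|s| / 2) : ℝ) : ℂ) := by
  simp only [synthCircuit, Circuit.eval, wordEval, List.map_map, Function.comp_def, Gate.eval,
    gateGenerator, smul_smul]
  congr 2
  funext g
  congr 2
  push_cast
  ring

lemma norm_gateGenerator_le (Q : Quadrature) (s : ℝ) (m : Mode) :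
    ‖gateGenerator Λ₁ Λ₂ Q s m‖ ≤ √(quadConst Λ₁ Λ₂ Q) := by
  have h1 : |modeSign s m| ≤ 1 := by
    cases m
    · simp [modeSign]
    · rcases lt_trichotomy s 0 with h | h | h <;> simp [modeSign, h]
  rw [gateGenerator, norm_smul, norm_mul, Complex.norm_I, one_mul, Complex.norm_real,
    Real.norm_eq_abs]
  exact (mul_le_of_le_one_left (norm_nonneg _) h1).trans
    ((norm_pauli_kronecker_le _ _).trans (norm_modeOp_le _ _ _ _))

/-- The commutator is $2i\,\mathrm{sgn}(s)\,\sigma^x\otimes Q_1Q_2$ and $z^2=|s|/2$, so the factor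
$2$ cancels and $\mathrm{sgn}(s)|s|=s$. -/
lemma exp_commutator_gateGenerator (Q : Quadrature) (s : ℝ) :
    NormedSpace.exp (((√(|s| / 2) : ℝ) : ℂ) ^ 2 •
      (gateGenerator Λ₁ Λ₂ Q s .one * gateGenerator Λ₁ Λ₂ Q s .two -
        gateGenerator Λ₁ Λ₂ Q s .two * gateGenerator Λ₁ Λ₂ Q s .one)) =
      blockEncoding (quadProduct Λ₁ Λ₂ Q) s := by
  rw [blockEncoding_of_isHermitian (quadProduct_isHermitian _ _ _)]
  have hsq : ((√(|s| / 2) : ℝ) : ℂ) ^ 2 = ((|s| / 2 : ℝ) : ℂ) := by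
    rw [← Complex.ofReal_pow, Real.sq_sqrt (by positivity)]
  have hs : ((SignType.sign s : ℝ) : ℂ) * (|s| : ℝ) = s := by
    rw [← Complex.ofReal_mul, sign_mul_abs]
  have hc : (pauli .z * pauli .y) ⊗ₖ quadProduct Λ₁ Λ₂ Q -
      (pauli .y * pauli .z) ⊗ₖ quadProduct Λ₁ Λ₂ Q =
      (-2 * Complex.I) • (pauli .x ⊗ₖ quadProduct Λ₁ Λ₂ Q) := by
    rw [← smul_kronecker, ← pauli_commutator, sub_eq_add_neg, sub_eq_add_neg, add_kronecker,
      ← neg_one_smul ℂ (pauli .y * pauli .z), smul_kronecker, neg_one_smul]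
  simp only [gateGenerator, modeSign, modeAxis, smul_mul_assoc, mul_smul_comm, smul_smul,
    ← mul_kronecker_mul, modeOp_commute, hsq]
  rw [← quadProduct, mul_comm (Complex.I * ((SignType.sign s : ℝ) : ℂ)), ← smul_sub, hc, smul_smul, smul_smul]
  congr 2
  push_cast
  linear_combination (-Complex.I ^ 3) * hs - s * Complex.I * Complex.I_sq

/-- The anti-Hermitian generators of the block encodings of `x̂₁ x̂₂` and `p̂₁ p̂₂`. -/
noncomputable def blockGenerator (Q : Quadrature) : Matrix (Hybrid Λ₁ Λ₂) (Hybrid Λ₁ Λ₂) ℂ :=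
  Complex.I • (pauli .x ⊗ₖ quadProduct Λ₁ Λ₂ Q)

lemma norm_blockGenerator_le (Q : Quadrature) :
    ‖blockGenerator Λ₁ Λ₂ Q‖ ≤ beamSplitterConst Λ₁ Λ₂ := by
  rw [blockGenerator, norm_smul, Complex.norm_I, one_mul]
  exact (norm_pauli_kronecker_le _ _).trans
    ((norm_quadProduct_le _ _ _).trans (quadConst_le _ _ _))

lemma wordEval_blockGenerator (w : List (Quadrature × ℝ)) (t : ℝ) :
    wordEval (blockGenerator Λ₁ Λ₂) w t =
      (w.map fun f => blockEncoding (quadProduct Λ₁ Λ₂ f.1) (f.2 * t)).prod := by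
  simp only [wordEval, blockGenerator, smul_smul,
    blockEncoding_of_isHermitian (quadProduct_isHermitian _ _ _)]
  congr 2
  funext g
  congr 2
  push_cast
  ring

lemma exp_add_blockGenerator (t : ℝ) :
    NormedSpace.exp ((t : ℂ) • (blockGenerator Λ₁ Λ₂ .x + blockGenerator Λ₁ Λ₂ .p)) =
      blockEncoding (beamSplitterOp Λ₁ Λ₂) t := by
  rw [blockEncoding_of_isHermitian (beamSplitterOp_isHermitian _ _), blockGenerator,
    blockGenerator, ← smul_add, ← kronecker_add, smul_smul, mul_comm, beamSplitterOp]

end Modes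

/-! ### Assembly of the two product formulas -/

/-- Errors of contractions add up along a product. -/
lemma norm_list_prod_sub_le {α R : Type*} [NormedRing R] [NormOneClass R] (f g : α → R)
    (hf : ∀ a, ‖f a‖ ≤ 1) (hg : ∀ a, ‖g a‖ ≤ 1) (l : List α) :
    ‖(l.map f).prod - (l.map g).prod‖ ≤ (l.map fun a => ‖f a - g a‖).sum := by
  induction l with
  | nil => simp
  | cons a l ih =>
    simp only [List.map_cons, List.prod_cons, List.sum_cons]
    have hl : ‖(l.map f).prod‖ ≤ 1 := norm_list_prod_le_one fun b hb => by
      obtain ⟨c, -, rfl⟩ := List.mem_map.mp hb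
      exact hf c
    have e : f a * (l.map f).prod - g a * (l.map g).prod =
        (f a - g a) * (l.map f).prod + g a * ((l.map f).prod - (l.map g).prod) := by
      noncomm_ring
    rw [e]
    refine (norm_add_le _ _).trans (add_le_add ?_ ?_)
    · exact (norm_mul_le _ _).trans (mul_le_of_le_one_right (norm_nonneg _) hl)
    · exact (norm_mul_le _ _).trans ((mul_le_of_le_one_left (norm_nonneg _) (hg a)).trans ih)

lemma eval_flatMap (Λ₁ Λ₂ : ℕ) {α : Type*} (l : List α) (F : α → Circuit) :
    Circuit.eval Λ₁ Λ₂ (l.flatMap F) = (l.map fun a => (F a).eval Λ₁ Λ₂).prod := by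
  induction l with
  | nil => simp [Circuit.eval]
  | cons a l ih =>
    rw [List.flatMap_cons, List.map_cons, List.prod_cons, ← ih]
    simp [Circuit.eval]

/-- Synthesis of the block encodings of `x̂₁ x̂₂` and `p̂₁ p̂₂`, uniformly in the cutoffs. -/
lemma exists_synthesis (k : ℕ) :
    ∃ (K : ℝ) (synth : Quadrature → ℝ → Circuit), 0 ≤ K ∧
      (∀ Q s, (synth Q s).length = 4 * 6 ^ k) ∧
      ∀ (Λ₁ Λ₂ : ℕ) (Q : Quadrature) (s : ℝ),
        ‖(synth Q s).eval Λ₁ Λ₂ - blockEncoding (quadProduct Λ₁ Λ₂ Q) s‖ ≤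
          K * (quadConst Λ₁ Λ₂ Q * |s|) ^ ((k : ℝ) + 3 / 2) := by
  obtain ⟨w, hlen, hw⟩ := exists_commutator_word Mode.one Mode.two k
  obtain ⟨K, hK, hb⟩ := exists_uniform_commutator_bound (ℕ × ℕ)
    (fun Λ => Matrix (Hybrid Λ.1 Λ.2) (Hybrid Λ.1 Λ.2) ℂ) hw
  refine ⟨K, synthCircuit w, hK, fun Q s => by simp [synthCircuit, hlen],
    fun Λ₁ Λ₂ Q s => ?_⟩
  have h2 := norm_sub_le_two (norm_circuit_eval_le_one Λ₁ Λ₂ (synthCircuit w Q s))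
    (norm_blockEncoding_le_one (quadProduct_isHermitian Λ₁ Λ₂ Q) s)
  have h := hb (Λ₁, Λ₂) (gateGenerator Λ₁ Λ₂ Q s) √(quadConst Λ₁ Λ₂ Q) √(|s| / 2)
    (Real.sqrt_nonneg _) (norm_gateGenerator_le Λ₁ Λ₂ Q s)
  rw [exp_commutator_gateGenerator, ← eval_synthCircuit] at h
  refine (h h2).trans (mul_le_mul_of_nonneg_left ?_ hK)
  have hM := quadConst_nonneg Λ₁ Λ₂ Q
  rw [abs_of_nonneg (Real.sqrt_nonneg _), ← Real.sqrt_mul hM, Real.sqrt_eq_rpow,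
    ← Real.rpow_mul (by positivity)]
  -- The order in $s$ is half the order $2k+3$ in $z$, since $z\propto\sqrt{|s|}$.
  rw [show (1 / 2 : ℝ) * ((2 * k + 3 : ℕ) : ℝ) = (k : ℝ) + 3 / 2 by push_cast; ring]
  refine Real.rpow_le_rpow (by positivity) ?_ (by positivity)
  exact mul_le_mul_of_nonneg_left (half_le_self (abs_nonneg s)) hM

/-- Splitting of the conditional beam splitter into block encodings of `x̂₁ x̂₂` and `p̂₁ p̂₂`,
uniformly in the cutoffs. -/
lemma exists_splitting (k : ℕ) {q : ℝ} (hq : 0 ≤ q) (hqk : q ≤ 2 * k + 3) :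
    ∃ (K : ℝ) (word : List (Quadrature × ℝ)), 0 ≤ K ∧ word.length = 3 * 5 ^ k ∧
      ∀ (Λ₁ Λ₂ : ℕ) (t : ℝ), 0 ≤ t →
        ‖(word.map fun f => blockEncoding (quadProduct Λ₁ Λ₂ f.1) (f.2 * t)).prod -
            blockEncoding (beamSplitterOp Λ₁ Λ₂) t‖ ≤
          K * (beamSplitterConst Λ₁ Λ₂ * t) ^ q := by
  obtain ⟨w, hlen, -, hw⟩ := exists_symmetric_word Quadrature.x Quadrature.p k
  obtain ⟨K, hK, hb⟩ := exists_uniform_symmetric_bound (ℕ × ℕ)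
    (fun Λ => Matrix (Hybrid Λ.1 Λ.2) (Hybrid Λ.1 Λ.2) ℂ) hw hq (by exact_mod_cast hqk)
  refine ⟨K, w, hK, hlen, fun Λ₁ Λ₂ t ht => ?_⟩
  have h := hb (Λ₁, Λ₂) (blockGenerator Λ₁ Λ₂) (beamSplitterConst Λ₁ Λ₂) t
    ((quadConst_nonneg Λ₁ Λ₂ .x).trans (quadConst_le Λ₁ Λ₂ .x)) (norm_blockGenerator_le Λ₁ Λ₂)
  rw [wordEval_blockGenerator, exp_add_blockGenerator, abs_of_nonneg ht] at h
  refine h (norm_sub_le_two (norm_list_prod_le_one fun a ha => ?_)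
    (norm_blockEncoding_le_one (beamSplitterOp_isHermitian Λ₁ Λ₂) t))
  obtain ⟨f, -, rfl⟩ := List.mem_map.mp ha
  exact norm_blockEncoding_le_one (quadProduct_isHermitian Λ₁ Λ₂ _) _

/-- $k\le(p-1)/2\le p/2-1/4$, and $3\le4$. -/
lemma suzuki_length_le {p k : ℕ} (hk : 2 * k + 1 ≤ p) :
    ((3 * 5 ^ k : ℕ) : ℝ) ≤ 4 * (5 : ℝ) ^ ((p : ℝ) / 2 - 1 / 4) := by
  have h1 : (5 : ℝ) ^ k ≤ (5 : ℝ) ^ ((p : ℝ) / 2 - 1 / 4) := by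
    rw [← Real.rpow_natCast]
    refine Real.rpow_le_rpow_of_exponent_le (by norm_num) ?_
    have : (2 * k + 1 : ℝ) ≤ p := by exact_mod_cast hk
    linarith
  push_cast
  nlinarith [pow_pos (show (0 : ℝ) < 5 by norm_num) k]

end BeamSplitter

theorem mainTheorem11 (p : ℕ) (hp : 1 ≤ p) :
    ∃ (K : ℝ) (synth : BeamSplitter.Quadrature → ℝ → BeamSplitter.Circuit)
      (word : List (BeamSplitter.Quadrature × ℝ)),
      -- at most `4 · 5^(p/2 - 1/4)` synthesized exponentials
      ((word.length : ℝ) ≤ 4 * (5 : ℝ) ^ ((p : ℝ) / 2 - 1 / 4)) ∧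
      -- each of them made of at most `8 · 6^(p-1)` native exponentials
      (∀ (Q : BeamSplitter.Quadrature) (s : ℝ), (synth Q s).length ≤ 8 * 6 ^ (p - 1)) ∧
      -- each of them approximating `𝓑_{x̂₁x̂₂}(s)` or `𝓑_{p̂₁p̂₂}(s)`
      (∀ (Λ₁ Λ₂ : ℕ) (Q : BeamSplitter.Quadrature) (s : ℝ),
        ‖(synth Q s).eval Λ₁ Λ₂ -
            BeamSplitter.blockEncoding (BeamSplitter.quadProduct Λ₁ Λ₂ Q) s‖ ≤
          K * (BeamSplitter.quadConst Λ₁ Λ₂ Q * |s|) ^ ((p : ℝ) + 1 / 2)) ∧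
      -- their product approximates `𝓑_{x̂₁x̂₂ + p̂₁p̂₂}(t)`
      (∀ (Λ₁ Λ₂ : ℕ) (t : ℝ), 0 ≤ t →
        ‖BeamSplitter.Circuit.eval Λ₁ Λ₂ (word.flatMap fun f => synth f.1 (f.2 * t)) -
            BeamSplitter.blockEncoding (BeamSplitter.beamSplitterOp Λ₁ Λ₂) t‖ ≤
          K * (BeamSplitter.beamSplitterConst Λ₁ Λ₂ * t) ^ ((p : ℝ) + 1 / 2)) := by
  open BeamSplitter in
  -- The upper bound on $p$ gives the order $2k+3\ge p+1/2$; the lower one gives the length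
  -- estimate.
  obtain ⟨k, hk⟩ : ∃ k : ℕ, p ≤ 2 * k + 2 ∧ 2 * k + 1 ≤ p := ⟨(p - 1) / 2, by omega, by omega⟩
  have hkR : (p : ℝ) ≤ 2 * k + 2 := by exact_mod_cast hk.1
  obtain ⟨K₁, synth, hK₁, hlen, hsynth⟩ := exists_synthesis (p - 1)
  obtain ⟨K₂, word, hK₂, hwlen, hword⟩ := exists_splitting k (q := (p : ℝ) + 1 / 2)
    (by positivity) (by linarith)
  have hexp : ((p - 1 : ℕ) : ℝ) + 3 / 2 = (p : ℝ) + 1 / 2 := by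
    rw [Nat.cast_sub hp]; push_cast; ring
  rw [hexp] at hsynth
  have hq : (0 : ℝ) ≤ (p : ℝ) + 1 / 2 := by positivity
  generalize (p : ℝ) + 1 / 2 = q at hsynth hword hq ⊢
  -- The synthesis error at angle $ct$ is at most $K_1|c|^q(Ct)^q$; `S` totals these over the word
  -- and depends only on $p$.
  set S : ℝ := (word.map fun f => K₁ * |f.2| ^ q).sum with hS
  have hS0 : 0 ≤ S := List.sum_nonneg fun x hx => by
    obtain ⟨f, -, rfl⟩ := List.mem_map.mp hx
    positivity
  refine ⟨K₁ + S + K₂, synth, word, ?_, fun Q s => ?_, fun Λ₁ Λ₂ Q s => ?_,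
    fun Λ₁ Λ₂ t ht => ?_⟩
  · rw [hwlen]
    exact suzuki_length_le hk.2
  · rw [hlen]
    -- The actual length is $4\cdot6^{p-1}$, half of what is allowed.
    exact Nat.mul_le_mul_right _ (by norm_num)
  · have := quadConst_nonneg Λ₁ Λ₂ Q
    exact (hsynth Λ₁ Λ₂ Q s).trans
      (mul_le_mul_of_nonneg_right (by linarith) (by positivity))
  · have hC : 0 ≤ beamSplitterConst Λ₁ Λ₂ :=
      (quadConst_nonneg Λ₁ Λ₂ .x).trans (quadConst_le Λ₁ Λ₂ .x)
    have hsum : ‖(word.map fun f => (synth f.1 (f.2 * t)).eval Λ₁ Λ₂).prod -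
        (word.map fun f => blockEncoding (quadProduct Λ₁ Λ₂ f.1) (f.2 * t)).prod‖ ≤
        S * (beamSplitterConst Λ₁ Λ₂ * t) ^ q := by
      refine (norm_list_prod_sub_le _ _ (fun f => norm_circuit_eval_le_one _ _ _)
        (fun f => norm_blockEncoding_le_one (quadProduct_isHermitian _ _ _) _) word).trans ?_
      rw [hS, ← List.sum_map_mul_right]
      refine List.sum_le_sum fun f _ => (hsynth Λ₁ Λ₂ f.1 (f.2 * t)).trans ?_
      rw [mul_assoc, ← Real.mul_rpow (abs_nonneg _) (by positivity)]
      have := quadConst_nonneg Λ₁ Λ₂ f.1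
      refine mul_le_mul_of_nonneg_left (Real.rpow_le_rpow (by positivity) ?_ hq) hK₁
      rw [abs_mul, abs_of_nonneg ht, mul_left_comm]
      have := quadConst_le Λ₁ Λ₂ f.1
      gcongr
    rw [eval_flatMap]
    refine (norm_sub_le_norm_sub_add_norm_sub _ _ _).trans
      ((add_le_add hsum (hword Λ₁ Λ₂ t ht)).trans ?_)
    rw [← add_mul]
    exact mul_le_mul_of_nonneg_right (by linarith) (by positivity)
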